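/- Let $u$ and $y$ be indeterminates and put $q=(1+uy)/(1+y)$ and $n!_q=\prod_{i=1}^{n}(1+q+\cdots+q^{i-1})$. All power series below are formal power series in $x$ over the field $\mathbb{Q}(u,y)$. A digraph on $[n]=\{1,\dots,n\}$ is a set of ordered pairs $(s,t)$ with $s,t\in[n]$, $s\ne t$ (its edges); a descent is an edge $(s,t)$ with $s>t$. A digraph is strong if for all vertices $v,w$ there is a (possibly empty) directed path from $v$ to $w$. The descent-edge polynomial of a set $\mathscr{B}$ of digraphs on $[n]$ is $\sum_{G\in\mathscr{B}}u^{\mathrm{des}(G)}y^{\mathrm{e}(G)}$, where $\mathrm{des}(G)$ and $\mathrm{e}(G)$ are the numbers of descents and edges of $G$. Let $s_n(u,y)$ and $d_n(u,y)$ be the descent-edge polynomials of the set of strong digraphs on $[n]$ and of the set of all digraphs on $[n]$, respectively, and let $$S(x)=\sum_{n=1}^{\infty}s_n(u,y)\frac{x^n}{n!},\qquad D(x)=\sum_{n=0}^{\infty}d_n(u,y)\frac{x^n}{(1+y)^{\binom n2}\,n!_q}.$$ Let $\Delta$ be the bijection on formal power series given by $$\Delta\Bigl(\sum_{n\ge0}a_n\frac{x^n}{n!}\Bigr)=\sum_{n\ge0}a_n\frac{x^n}{(1+y)^{\binom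 n2}\,n!_q}.$$ Then $$D(x)=\sum_{n=0}^{\infty}(1+uy)^{\binom n2}\frac{x^n}{n!_q},$$ the series $D(x)$ has nonzero constant term, $\Delta^{-1}(D(x)^{-1})$ has constant term $1$, and $$S(x)=-\log\bigl(\Delta^{-1}(D(x)^{-1})\bigr),$$ where $\log(1+z)=\sum_{k\ge1}(-1)^{k+1}z^k/k$ for a power series $z$ with zero constant term. -/

import Mathlib

noncomputable section

namespace StrongDigraph

open scoped Classical

/-! ### Digraphs, descents and descent-edge polynomials -/

/-- The polynomials in the two indeterminates `u` (descents) and `y` (edges). -/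
abbrev Poly : Type := MvPolynomial (Fin 2) ℚ

/-- The indeterminate marking descents. -/
def uPoly : Poly := MvPolynomial.X 0

/-- The indeterminate marking edges. -/
def yPoly : Poly := MvPolynomial.X 1

/-- Digraphs on `n` totally ordered vertices, without loops. Mathlib's `Digraph` is an arbitrary
relation on the vertices, so looplessness is imposed here. -/
def allDigraphs (n : ℕ) : Set (Digraph (Fin n)) := {G | ∀ v, ¬ G.Adj v v}

/-- `G` is strong: there is a directed path, possibly empty, from every vertex to every vertex. -/
def IsStrong {V : Type*} (G : Digraph V) : Prop := ∀ v w, Relation.ReflTransGen G.Adj v w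

/-- Strong digraphs on `n` totally ordered vertices. -/
def strongDigraphs (n : ℕ) : Set (Digraph (Fin n)) := {G ∈ allDigraphs n | IsStrong G}

/-- The number of edges. -/
def edgeCount {n : ℕ} (G : Digraph (Fin n)) : ℕ :=
  (Finset.univ.filter fun e : Fin n × Fin n => G.Adj e.1 e.2).card

/-- The number of descents, that is, of edges `(s, t)` with `s > t`. -/
def desCount {n : ℕ} (G : Digraph (Fin n)) : ℕ :=
  (Finset.univ.filter fun e : Fin n × Fin n => G.Adj e.1 e.2 ∧ e.2 < e.1).card

/-- The descent-edge polynomial of a family of digraphs on `n` vertices. -/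
def descentEdgePoly {n : ℕ} (B : Set (Digraph (Fin n))) : Poly :=
  ∑ G ∈ (Set.toFinite B).toFinset, uPoly ^ desCount G * yPoly ^ edgeCount G

/-! ### Exponential and Eulerian graphic generating functions -/

/-- The field `ℚ(u, y)` of rational functions, over which the generating functions are taken. -/
abbrev RatUY : Type := FractionRing Poly

/-- The element `u` of `ℚ(u, y)`. -/
def u : RatUY := algebraMap Poly RatUY uPoly

/-- The element `y` of `ℚ(u, y)`. -/
def y : RatUY := algebraMap Poly RatUY yPoly

/-- `q = (1 + u y) / (1 + y)`. -/
def q : RatUY := (1 + u * y) / (1 + y)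

/-- The `q`-factorial `1 (1 + q) ⋯ (1 + q + ⋯ + q ^ (n - 1))`. -/
def qFactorial {K : Type*} [CommSemiring K] (q : K) (n : ℕ) : K :=
  ∏ i ∈ Finset.range n, ∑ j ∈ Finset.range (i + 1), q ^ j

/-- The exponential generating function `∑ aₙ xⁿ / n!`. -/
def expGF (a : ℕ → RatUY) : PowerSeries RatUY :=
  PowerSeries.mk fun n => a n / (n.factorial : RatUY)

/-- The denominator `(1 + y) ^ (n choose 2) * n!_q` of Eulerian graphic generating functions. -/
def egDenom (n : ℕ) : RatUY := (1 + y) ^ n.choose 2 * qFactorial q n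

/-- The Eulerian graphic generating function `∑ aₙ xⁿ / ((1 + y) ^ (n choose 2) n!_q)`, with
`q = (1 + u y) / (1 + y)`. -/
def eulerianGraphicGF (a : ℕ → RatUY) : PowerSeries RatUY :=
  PowerSeries.mk fun n => a n / egDenom n

theorem one_add_y_ne_zero : (1 + y : RatUY) ≠ 0 := by
  have h : (1 + y : RatUY) = algebraMap Poly RatUY (1 + yPoly) := by simp [y]
  rw [h, Ne, FaithfulSMul.algebraMap_eq_zero_iff]
  intro h0
  have := congrArg (MvPolynomial.eval fun _ => (0 : ℚ)) h0
  simp [yPoly] at this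

theorem q_sum_ne_zero (n : ℕ) : (∑ j ∈ Finset.range (n + 1), q ^ j : RatUY) ≠ 0 := by
  intro h0
  have h1 : algebraMap Poly RatUY
      (∑ j ∈ Finset.range (n + 1), (1 + uPoly * yPoly) ^ j * (1 + yPoly) ^ (n - j)) = 0 := by
    have h2 : (1 + y : RatUY) ^ n * ∑ j ∈ Finset.range (n + 1), q ^ j = 0 := by rw [h0, mul_zero]
    rw [← h2, Finset.mul_sum, map_sum]
    refine Finset.sum_congr rfl fun j hj => ?_
    have hjn : j ≤ n := Nat.lt_succ_iff.mp (Finset.mem_range.mp hj)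
    have hp : (1 + y : RatUY) ^ n = (1 + y) ^ (n - j) * (1 + y) ^ j := by
      rw [← pow_add, Nat.sub_add_cancel hjn]
    have hy := pow_ne_zero j one_add_y_ne_zero
    rw [q, div_pow, hp]
    simp only [map_mul, map_pow, map_add, map_one, ← u.eq_1, ← y.eq_1]
    field_simp
  rw [FaithfulSMul.algebraMap_eq_zero_iff] at h1
  have := congrArg (MvPolynomial.eval fun _ => (0 : ℚ)) h1
  simp [uPoly, yPoly] at this
  exact absurd this (by positivity)

theorem egDenom_ne_zero (n : ℕ) : egDenom n ≠ 0 :=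
  mul_ne_zero (pow_ne_zero _ one_add_y_ne_zero)
    (Finset.prod_ne_zero_iff.mpr fun i _ => q_sum_ne_zero i)

/-- The coefficient sequence `aₙ` of a series written as `∑ aₙ xⁿ / n!`. -/
theorem expGF_coeff (f : PowerSeries RatUY) :
    expGF (fun n => (n.factorial : RatUY) * PowerSeries.coeff n f) = f := by
  ext n
  simp [expGF, Nat.factorial_ne_zero]

/-- Every series is uniquely `∑ aₙ xⁿ / n!`. -/
def expGFEquiv : (ℕ → RatUY) ≃ PowerSeries RatUY where
  toFun := expGF
  invFun f n := (n.factorial : RatUY) * PowerSeries.coeff n f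
  left_inv a := by
    funext n
    have : (n.factorial : RatUY) ≠ 0 := Nat.cast_ne_zero.mpr n.factorial_ne_zero
    simp only [expGF, PowerSeries.coeff_mk]
    field_simp
  right_inv := expGF_coeff

/-- Every series is uniquely `∑ aₙ xⁿ / ((1 + y) ^ (n choose 2) n!_q)`. -/
def eulerianGraphicGFEquiv : (ℕ → RatUY) ≃ PowerSeries RatUY where
  toFun := eulerianGraphicGF
  invFun f n := egDenom n * PowerSeries.coeff n f
  left_inv a := by
    funext n
    have := egDenom_ne_zero n
    simp only [eulerianGraphicGF, PowerSeries.coeff_mk]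
    field_simp
  right_inv f := by
    ext n
    have := egDenom_ne_zero n
    simp only [eulerianGraphicGF, PowerSeries.coeff_mk]
    field_simp

/-- The bijection `Δ` that sends `∑ aₙ xⁿ / n!` to `∑ aₙ xⁿ / ((1 + y) ^ (n choose 2) n!_q)`. -/
def Delta : PowerSeries RatUY ≃ PowerSeries RatUY :=
  expGFEquiv.symm.trans eulerianGraphicGFEquiv

/-- The exponential generating function `S(x)` of the descent-edge polynomials of strong digraphs
on `n ≥ 1` vertices; the digraph without vertices is not counted. -/
def strongGF : PowerSeries RatUY :=
  expGF fun n => if n = 0 then 0 else algebraMap Poly RatUY (descentEdgePoly (strongDigraphs n))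

/-- The Eulerian graphic generating function `D(x)` of the descent-edge polynomials of all
digraphs. -/
def digraphGF : PowerSeries RatUY :=
  eulerianGraphicGF fun n => algebraMap Poly RatUY (descentEdgePoly (allDigraphs n))

end StrongDigraph

end

/-!
Why `S(x) = -log (Δ⁻¹ (D(x)⁻¹))` holds. Let `aₙ` be the coefficients of
`exp (-S(x)) = ∑ aₙ xⁿ / n!`. By the exponential formula, `aₙ` enumerates the disjoint unions of
strong digraphs on `n` vertices, each counted with the sign `(-1) ^ (number of components)`. The
claim is that `(∑ aₙ xⁿ / ((1 + y) ^ (n choose 2) n!_q)) * D(x) = 1`.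

In a product of two Eulerian graphic generating functions, the coefficients are combined with the
weights `(1 + y) ^ (k * (n - k)) * [n, k]_q`. Such a weight enumerates the pairs of a `k`-subset `B`
of `[n]` and a set of edges from `B` to its complement, because a pair in `B × Bᶜ` contributes
`1 + y` if it is an ascent and `1 + u y` if it is a descent (`sum_powerset_range_cross`,
`gaussBinom_mul_egDenom`). So the coefficient of the product enumerates the digraphs `G` on `[n]`
with a distinguished set `T` of source components (strong components that no edge enters from
outside) and sign `(-1) ^ |T|`: given `T` with union `B`, the digraph is strong on each member of
`T`, and the edges with heads outside `B` are free (`sum_subset_sources`). A digraph on `n ≥ 1`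
vertices has at least one source component (`sources_nonempty`), so the signs cancel for each `G`
separately (`sum_signedSum_eq_zero`).

The exponential formula enters as the recurrence that splits off the component of a fixed vertex
(`signedSum_eq_neg_sum`). It is the coefficient form of the differential equation `E' = -S' E` of
`E = exp (-S)`, which in turn determines `log E` (`logOf_eq_neg_of_derivative`).
-/

noncomputable section

namespace StrongDigraph

open scoped Classical
open Finset

/-! ### Source components and the cancellation identity -/

section EdgeSets

variable {V R : Type*} [DecidableEq V] [CommRing R]

/-- The edge set `E` induces a strong digraph on the vertex set `C`: every two vertices of `C` are
joined by a directed path that stays in `C`. Loops never matter, so only edges in `C.offDiag` are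
used. -/
def StrongOn (C : Finset V) (E : Finset (V × V)) : Prop :=
  ∀ v ∈ C, ∀ v' ∈ C, Relation.ReflTransGen (fun a b => (a, b) ∈ E ∧ (a, b) ∈ C.offDiag) v v'

/-- The source components of the digraph with vertex set `A` and edge set `E`: the nonempty sets of
vertices that induce a strong digraph and that no edge enters from outside. -/
def sources (A : Finset V) (E : Finset (V × V)) : Finset (Finset V) :=
  A.powerset.filter fun C => C.Nonempty ∧ StrongOn C E ∧ ∀ e ∈ E, e.2 ∈ C → e.1 ∈ C

/-- The weight enumerator of the strong loopless digraphs on the vertex set `C`, an edge `e` having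
weight `w e`. -/
def strongSum (w : V × V → R) (C : Finset V) : R :=
  ∑ E ∈ C.offDiag.powerset with StrongOn C E, ∏ e ∈ E, w e

/-- The packings of `A`: the sets of pairwise disjoint nonempty subsets of `A`. -/
def packings (A : Finset V) : Finset (Finset (Finset V)) :=
  A.powerset.powerset.filter fun T => ∅ ∉ T ∧ (T : Set (Finset V)).PairwiseDisjoint id

/-- The signed enumerator of the disjoint unions of strong digraphs with vertex set `A`, each
component contributing a factor `-1`. The sum is over the set partitions of `A`. -/
def signedSum (w : V × V → R) (A : Finset V) : R :=
  ∑ T ∈ packings A with T.biUnion id = A, ∏ C ∈ T, -strongSum w C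

theorem mem_sources {A C : Finset V} {E : Finset (V × V)} : C ∈ sources A E ↔
    C ⊆ A ∧ C.Nonempty ∧ StrongOn C E ∧ ∀ e ∈ E, e.2 ∈ C → e.1 ∈ C := by
  simp [sources]

theorem mem_packings {A : Finset V} {T : Finset (Finset V)} : T ∈ packings A ↔
    (∀ C ∈ T, C ⊆ A) ∧ ∅ ∉ T ∧ (T : Set (Finset V)).PairwiseDisjoint id := by
  simp [packings, Finset.subset_iff]

theorem strongOn_inter {C : Finset V} {E Z : Finset (V × V)} (h : C.offDiag ⊆ Z) :
    StrongOn C (E ∩ Z) ↔ StrongOn C E := by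
  have : ∀ a b : V, ((a, b) ∈ E ∩ Z ∧ (a, b) ∈ C.offDiag) ↔ ((a, b) ∈ E ∧ (a, b) ∈ C.offDiag) :=
    fun a b => ⟨fun h' => ⟨(mem_inter.1 h'.1).1, h'.2⟩,
      fun h' => ⟨mem_inter.2 ⟨h'.1, h h'.2⟩, h'.2⟩⟩
  simp only [StrongOn, this]

/-- A path that ends in a set closed under predecessors stays in that set. -/
theorem reflTransGen_offDiag {C : Finset V} {E : Finset (V × V)}
    (hC : ∀ e ∈ E, e.2 ∈ C → e.1 ∈ C) {a b : V}
    (h : Relation.ReflTransGen (fun a b => (a, b) ∈ E) a b) (hb : b ∈ C) :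
    a ∈ C ∧ Relation.ReflTransGen (fun a b => (a, b) ∈ E ∧ (a, b) ∈ C.offDiag) a b := by
  induction h using Relation.ReflTransGen.head_induction_on with
  | refl => exact ⟨hb, .refl⟩
  | head h1 h2 ih =>
    rename_i c d
    have hc := hC _ h1 ih.1
    refine ⟨hc, ?_⟩
    by_cases hcd : c = d
    · exact hcd ▸ ih.2
    · exact .head ⟨h1, mem_offDiag.2 ⟨hc, ih.1, hcd⟩⟩ ih.2

theorem sources_subset_of_mem {A C C' : Finset V} {E : Finset (V × V)} (hC : C ∈ sources A E)
    (hC' : C' ∈ sources A E) {v : V} (hv : v ∈ C) (hv' : v ∈ C') : C' ⊆ C := by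
  intro x hx
  rw [mem_sources] at hC hC'
  exact (reflTransGen_offDiag hC.2.2.2
    (Relation.ReflTransGen.mono (fun _ _ h => h.1) _ _ (hC'.2.2.1 x hx v hv')) hv).1

theorem sources_pairwiseDisjoint (A : Finset V) (E : Finset (V × V)) :
    (sources A E : Set (Finset V)).PairwiseDisjoint id := by
  intro C hC C' hC' hne
  rw [Function.onFun, id, id, Finset.disjoint_left]
  intro v hv hv'
  exact hne ((sources_subset_of_mem hC' hC hv' hv).antisymm (sources_subset_of_mem hC hC' hv hv'))

/-- Every nonempty digraph has a source component, namely the set of ancestors of a vertex with the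
fewest ancestors. -/
theorem sources_nonempty {A : Finset V} (hA : A.Nonempty) {E : Finset (V × V)}
    (hE : E ⊆ A.offDiag) : (sources A E).Nonempty := by
  let anc : V → Finset V := fun v =>
    A.filter fun a => Relation.ReflTransGen (fun a b => (a, b) ∈ E) a v
  obtain ⟨v, hv, hmin⟩ := A.exists_min_image (fun v => (anc v).card) hA
  have hcl : ∀ e ∈ E, e.2 ∈ anc v → e.1 ∈ anc v := fun e he h => by
    rw [mem_filter] at h ⊢
    exact ⟨(mem_offDiag.1 (hE he)).1, .head he h.2⟩
  refine ⟨anc v, mem_sources.2 ⟨filter_subset _ _, ⟨v, mem_filter.2 ⟨hv, .refl⟩⟩, ?_, hcl⟩⟩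
  intro x hx x' hx'
  have hx'' := mem_filter.1 hx'
  have hsub : anc x' ⊆ anc v := fun z hz => by
    rw [mem_filter] at hz ⊢
    exact ⟨hz.1, hz.2.trans hx''.2⟩
  -- Minimality makes all ancestors of `v` have the same ancestors as `v`.
  have heq : anc x' = anc v := eq_of_subset_of_card_le hsub (hmin x' hx''.1)
  rw [← heq] at hx
  exact (reflTransGen_offDiag hcl (mem_filter.1 hx).2 hx').2

/-- Sums over edge sets factor over disjoint regions. -/
theorem sum_powerset_disjUnion (w : V × V → R) {Y Z : Finset (V × V)} (h : Disjoint Y Z)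
    (P Q : Finset (V × V) → Prop) [DecidablePred P] [DecidablePred Q] :
    ∑ E ∈ (Y ∪ Z).powerset with P (E ∩ Y) ∧ Q (E ∩ Z), ∏ e ∈ E, w e =
      (∑ E ∈ Y.powerset with P E, ∏ e ∈ E, w e) * ∑ E ∈ Z.powerset with Q E, ∏ e ∈ E, w e := by
  rw [sum_mul_sum, ← sum_product']
  have key : ∀ E F, E ⊆ Y → F ⊆ Z → (E ∪ F) ∩ Y = E ∧ (E ∪ F) ∩ Z = F := by
    intro E F hE hF
    rw [Finset.disjoint_left] at h
    constructor <;> ext e <;> simp only [mem_inter, mem_union] <;> constructor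
    · rintro ⟨h1 | h1, h2⟩
      exacts [h1, (h h2 (hF h1)).elim]
    · exact fun h1 => ⟨.inl h1, hE h1⟩
    · rintro ⟨h1 | h1, h2⟩
      exacts [(h (hE h1) h2).elim, h1]
    · exact fun h1 => ⟨.inr h1, hF h1⟩
  symm
  refine sum_bij' (fun p _ => p.1 ∪ p.2) (fun E _ => (E ∩ Y, E ∩ Z)) ?_ ?_ ?_ ?_ ?_
  · rintro ⟨E, F⟩ hp
    simp only [mem_product, mem_filter, mem_powerset] at hp ⊢
    obtain ⟨k1, k2⟩ := key E F hp.1.1 hp.2.1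
    rw [k1, k2]
    exact ⟨union_subset_union hp.1.1 hp.2.1, hp.1.2, hp.2.2⟩
  · intro E hE
    simp only [mem_product, mem_filter, mem_powerset] at hE ⊢
    exact ⟨⟨inter_subset_right, hE.2.1⟩, inter_subset_right, hE.2.2⟩
  · rintro ⟨E, F⟩ hp
    simp only [mem_product, mem_filter, mem_powerset] at hp
    obtain ⟨k1, k2⟩ := key E F hp.1.1 hp.2.1
    simp only [k1, k2]
  · intro E hE
    simp only [mem_filter, mem_powerset] at hE
    simp only [← inter_union_distrib_left]
    exact inter_eq_left.2 hE.1
  · rintro ⟨E, F⟩ hp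
    simp only [mem_product, mem_filter, mem_powerset] at hp
    exact (prod_union (disjoint_of_subset_left hp.1.1 (disjoint_of_subset_right hp.2.1 h))).symm

/-- The digraphs that induce strong digraphs on the disjoint sets in `T`, all other edges being
chosen freely from `X`. -/
theorem sum_strongOn_all (w : V × V → R) (X : Finset (V × V)) (T : Finset (Finset V))
    (hT : (T : Set (Finset V)).PairwiseDisjoint id) (hX : ∀ C ∈ T, ∀ e ∈ X, e.2 ∉ C) :
    ∑ E ∈ (X ∪ T.biUnion offDiag).powerset with ∀ C ∈ T, StrongOn C E, ∏ e ∈ E, w e =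
      (∏ C ∈ T, strongSum w C) * ∏ e ∈ X, (1 + w e) := by
  induction T using Finset.induction_on with
  | empty => simp [prod_one_add]
  | insert C T hCT ih =>
    have hdis : Disjoint (X ∪ T.biUnion offDiag) C.offDiag := by
      rw [Finset.disjoint_left]
      rintro e he heC
      have h2 := (mem_offDiag.1 heC).2.1
      rcases mem_union.1 he with he | he
      · exact hX C (mem_insert_self _ _) e he h2
      · obtain ⟨C', hC', he'⟩ := mem_biUnion.1 he
        have hne : C ≠ C' := fun h => hCT (h ▸ hC')
        exact Finset.disjoint_left.1
          (hT (mem_coe.2 (mem_insert_self _ _)) (mem_coe.2 (mem_insert_of_mem hC')) hne)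
          h2 (mem_offDiag.1 he').2.1
    have hU : X ∪ (insert C T).biUnion offDiag = (X ∪ T.biUnion offDiag) ∪ C.offDiag := by
      rw [biUnion_insert, union_comm C.offDiag, union_assoc]
    rw [prod_insert hCT, mul_comm (strongSum w C), mul_right_comm,
      ← ih (hT.subset (by simp)) fun C' hC' => hX C' (mem_insert_of_mem hC'), strongSum,
      ← sum_powerset_disjUnion w hdis, hU]
    refine sum_congr (filter_congr fun E _ => ?_) fun _ _ => rfl
    rw [strongOn_inter (Subset.refl _), forall_mem_insert, and_comm]
    refine and_congr_left fun _ => forall₂_congr fun C' hC' => ?_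
    rw [strongOn_inter]
    exact (subset_biUnion_of_mem offDiag hC').trans subset_union_right

/-- The weight enumerator of the digraphs on `A` of which all members of the packing `T` are source
components: the edges outside these components are exactly those whose head is outside the union of
`T`, and they are free. -/
theorem sum_subset_sources (w : V × V → R) {A : Finset V} {T : Finset (Finset V)}
    (hT : T ∈ packings A) :
    ∑ E ∈ A.offDiag.powerset with T ⊆ sources A E, ∏ e ∈ E, w e =
      (∏ C ∈ T, strongSum w C) *
        ((∏ e ∈ T.biUnion id ×ˢ (A \ T.biUnion id), (1 + w e)) *
          ∏ e ∈ (A \ T.biUnion id).offDiag, (1 + w e)) := by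
  obtain ⟨hTA, hT0, hTd⟩ := mem_packings.1 hT
  have hUA : T.biUnion id ⊆ A := biUnion_subset.2 hTA
  have hmem : ∀ C ∈ T, C ⊆ T.biUnion id := fun C hC => subset_biUnion_of_mem id hC
  generalize hU : T.biUnion id = U at *
  rw [← prod_union, ← sum_strongOn_all w _ T hTd]
  · refine sum_congr ?_ fun _ _ => rfl
    ext E
    simp only [mem_filter, mem_powerset]
    constructor
    · rintro ⟨hE, hS⟩
      refine ⟨fun e he => ?_, fun C hC => (mem_sources.1 (hS hC)).2.2.1⟩
      obtain ⟨h1, h2, h3⟩ := mem_offDiag.1 (hE he)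
      by_cases hh : e.2 ∈ U
      · rw [← hU] at hh
        obtain ⟨C, hC, hh⟩ := mem_biUnion.1 hh
        refine mem_union_right _ (mem_biUnion.2 ⟨C, hC, mem_offDiag.2 ⟨?_, hh, h3⟩⟩)
        exact (mem_sources.1 (hS hC)).2.2.2 e he hh
      · refine mem_union_left _ ?_
        by_cases ht : e.1 ∈ U
        · exact mem_union_left _ (mem_product.2 ⟨ht, mem_sdiff.2 ⟨h2, hh⟩⟩)
        · exact mem_union_right _
            (mem_offDiag.2 ⟨mem_sdiff.2 ⟨h1, ht⟩, mem_sdiff.2 ⟨h2, hh⟩, h3⟩)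
    · rintro ⟨hE, hS⟩
      have hE' : ∀ e ∈ E, e ∈ A.offDiag ∧ ∀ C ∈ T, e.2 ∈ C → e.1 ∈ C := by
        intro e he
        rcases mem_union.1 (hE he) with h | h
        · have h' : e ∈ A.offDiag ∧ e.2 ∉ U := by
            rcases mem_union.1 h with h | h
            · obtain ⟨h1, h2⟩ := mem_product.1 h
              obtain ⟨h2, h3⟩ := mem_sdiff.1 h2
              exact ⟨mem_offDiag.2 ⟨hUA h1, h2, fun h => h3 (h ▸ h1)⟩, h3⟩
            · exact ⟨offDiag_mono sdiff_subset h, (mem_sdiff.1 (mem_offDiag.1 h).2.1).2⟩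
          exact ⟨h'.1, fun C hC hh => (h'.2 (hmem C hC hh)).elim⟩
        · obtain ⟨C, hC, h⟩ := mem_biUnion.1 h
          refine ⟨offDiag_mono (hTA C hC) h, fun C' hC' hh => ?_⟩
          obtain ⟨h1, h2, -⟩ := mem_offDiag.1 h
          have : C = C' := hTd.elim_finset hC hC' e.2 h2 hh
          exact this ▸ h1
      refine ⟨fun e he => (hE' e he).1, fun C hC => mem_sources.2 ⟨hTA C hC, ?_, hS C hC,
        fun e he => (hE' e he).2 C hC⟩⟩
      exact nonempty_iff_ne_empty.2 fun h => hT0 (h ▸ hC)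
  · intro C hC e he hh
    have := hmem C hC hh
    rcases mem_union.1 he with h | h
    · exact (mem_sdiff.1 (mem_product.1 h).2).2 this
    · exact (mem_sdiff.1 (mem_offDiag.1 h).2.1).2 this
  · rw [Finset.disjoint_left]
    exact fun e h h' => (mem_sdiff.1 (mem_offDiag.1 h').1).2 (mem_product.1 h).1

/-- A nonempty digraph has a source component, so the signed count of its sets of source components
vanishes. Summed over all digraphs on `A`, with the digraphs grouped by the set of vertices covered
by the chosen source components, this is the identity behind `D(x)⁻¹`. -/
theorem sum_signedSum_eq_zero (w : V × V → R) {A : Finset V} (hA : A.Nonempty) :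
    ∑ B ∈ A.powerset, signedSum w B *
      ((∏ e ∈ B ×ˢ (A \ B), (1 + w e)) * ∏ e ∈ (A \ B).offDiag, (1 + w e)) = 0 := by
  have hpack : ∀ B ∈ A.powerset,
      (packings B).filter (fun T => T.biUnion id = B) =
        (packings A).filter fun T => T.biUnion id = B := by
    intro B hB
    ext T
    simp only [mem_filter, mem_packings, and_congr_left_iff]
    rintro hU -
    have h1 : ∀ C ∈ T, C ⊆ B := fun C hC => hU ▸ subset_biUnion_of_mem id hC
    exact iff_of_true h1 fun C hC => (h1 C hC).trans (mem_powerset.1 hB)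
  calc _ = ∑ B ∈ A.powerset, ∑ T ∈ packings A with T.biUnion id = B,
        ∑ E ∈ A.offDiag.powerset with T ⊆ sources A E, (-1) ^ T.card * ∏ e ∈ E, w e := by
        refine sum_congr rfl fun B hB => ?_
        rw [signedSum, hpack B hB, sum_mul]
        refine sum_congr rfl fun T hT => ?_
        obtain ⟨hT', rfl⟩ := mem_filter.1 hT
        rw [← mul_sum, sum_subset_sources w hT', prod_neg, mul_assoc]
    _ = ∑ T ∈ packings A, ∑ E ∈ A.offDiag.powerset with T ⊆ sources A E,
          (-1) ^ T.card * ∏ e ∈ E, w e :=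
        sum_fiberwise_of_maps_to
          (fun T hT => mem_powerset.2 (biUnion_subset.2 (mem_packings.1 hT).1)) _
    _ = ∑ E ∈ A.offDiag.powerset, ∑ T ∈ (sources A E).powerset,
          (-1) ^ T.card * ∏ e ∈ E, w e := by
        refine sum_comm' fun T E => ?_
        simp only [mem_filter, mem_powerset]
        constructor
        · rintro ⟨-, hE, hT⟩
          exact ⟨hT, hE⟩
        · rintro ⟨hT, hE⟩
          refine ⟨mem_packings.2 ⟨fun C hC => (mem_sources.1 (hT hC)).1, fun h => ?_,
            (sources_pairwiseDisjoint A E).subset (coe_subset.2 hT)⟩, hE, hT⟩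
          exact not_nonempty_empty (mem_sources.1 (hT h)).2.1
    _ = 0 := by
        refine sum_eq_zero fun E hE => ?_
        have h := sum_powerset_neg_one_pow_card_of_nonempty
          (sources_nonempty hA (mem_powerset.1 hE))
        have h' : (∑ T ∈ (sources A E).powerset, (-1 : R) ^ T.card) = 0 := by
          exact_mod_cast congrArg (Int.cast : ℤ → R) h
        rw [← sum_mul, h', zero_mul]

theorem signedSum_empty (w : V × V → R) : signedSum w ∅ = 1 := by
  have : (packings (∅ : Finset V)).filter (fun T => T.biUnion id = ∅) = {∅} := by
    ext T
    simp only [mem_filter, mem_packings, mem_singleton]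
    constructor
    · rintro ⟨⟨h1, h2, -⟩, -⟩
      refine eq_empty_of_forall_notMem fun C hC => h2 ?_
      rwa [← subset_empty.1 (h1 C hC)]
    · rintro rfl
      simp
  rw [signedSum, this, sum_singleton, prod_empty]

/-- Splitting off the component that contains a given vertex `m`. -/
theorem signedSum_eq_neg_sum (w : V × V → R) {A : Finset V} {m : V} (hm : m ∈ A) :
    signedSum w A = -∑ C ∈ A.powerset with m ∈ C, strongSum w C * signedSum w (A \ C) := by
  rw [← sum_neg_distrib]
  calc signedSum w A = ∑ T ∈ packings A with T.biUnion id = A,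
        ∑ C ∈ T with m ∈ C, ∏ C ∈ T, -strongSum w C := by
        refine sum_congr rfl fun T hT => ?_
        obtain ⟨hT, hU⟩ := mem_filter.1 hT
        obtain ⟨C, hC, hmC⟩ := mem_biUnion.1 (hU.symm ▸ hm)
        have : T.filter (fun C => m ∈ C) = {C} := by
          ext C'
          simp only [mem_filter, mem_singleton]
          constructor
          · rintro ⟨hC', hmC'⟩
            exact (mem_packings.1 hT).2.2.elim_finset hC' hC m hmC' hmC
          · rintro rfl
            exact ⟨hC, hmC⟩
        rw [this, sum_singleton]
    _ = ∑ C ∈ A.powerset with m ∈ C,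
          ∑ T ∈ packings A with T.biUnion id = A ∧ C ∈ T, ∏ C ∈ T, -strongSum w C := by
        refine sum_comm' fun T C => ?_
        simp only [mem_filter, mem_powerset]
        constructor
        · rintro ⟨⟨h1, h2⟩, h3, h4⟩
          exact ⟨⟨h1, h2, h3⟩, (mem_packings.1 h1).1 C h3, h4⟩
        · rintro ⟨⟨h1, h2, h3⟩, -, h4⟩
          exact ⟨⟨h1, h2⟩, h3, h4⟩
    _ = _ := by
        refine sum_congr rfl fun C hC => ?_
        simp only [mem_filter, mem_powerset] at hC
        obtain ⟨hCA, hmC⟩ := hC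
        rw [signedSum, mul_sum, ← sum_neg_distrib]
        have hdis : ∀ T ∈ packings A, C ∈ T → ∀ C' ∈ T.erase C, Disjoint C' C := by
          intro T hT hC C' hC'
          exact (mem_packings.1 hT).2.2 (mem_of_mem_erase hC') hC (ne_of_mem_erase hC')
        have hnot : ∀ T ∈ packings (A \ C), C ∉ T := fun T hT hC =>
          (mem_sdiff.1 ((mem_packings.1 hT).1 C hC hmC)).2 hmC
        refine sum_bij' (fun T _ => T.erase C) (fun T _ => insert C T) ?_ ?_ ?_ ?_ ?_
        · intro T hT
          simp only [mem_filter] at hT ⊢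
          obtain ⟨hT, hU, hC⟩ := hT
          obtain ⟨h1, h2, h3⟩ := mem_packings.1 hT
          have h4 : ∀ C' ∈ T.erase C, C' ⊆ A \ C := fun C' hC' =>
            subset_sdiff.2 ⟨h1 C' (mem_of_mem_erase hC'), hdis T hT hC C' hC'⟩
          refine ⟨mem_packings.2 ⟨h4, fun h => h2 (mem_of_mem_erase h),
            h3.subset (coe_subset.2 (erase_subset _ _))⟩, (biUnion_subset.2 h4).antisymm ?_⟩
          intro v hv
          obtain ⟨hvA, hvC⟩ := mem_sdiff.1 hv
          obtain ⟨C', hC', hv'⟩ := mem_biUnion.1 (hU.symm ▸ hvA)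
          refine mem_biUnion.2 ⟨C', mem_erase.2 ⟨?_, hC'⟩, hv'⟩
          rintro rfl
          exact hvC hv'
        · intro T hT
          simp only [mem_filter] at hT ⊢
          obtain ⟨hT, hU⟩ := hT
          obtain ⟨h1, h2, h3⟩ := mem_packings.1 hT
          refine ⟨mem_packings.2 ⟨?_, ?_, ?_⟩, ?_, mem_insert_self _ _⟩
          · exact forall_mem_insert _ _ _ |>.2 ⟨hCA, fun C' hC' => (h1 C' hC').trans sdiff_subset⟩
          · intro h
            rcases mem_insert.1 h with h | h
            · exact notMem_empty m (h ▸ hmC)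
            · exact h2 h
          · rw [coe_insert]
            refine h3.insert fun C' hC' _ => ?_
            exact (subset_sdiff.1 (h1 C' hC')).2.symm
          · rw [biUnion_insert, hU, id, union_sdiff_of_subset hCA]
        · intro T hT
          exact insert_erase (mem_filter.1 hT).2.2
        · intro T hT
          exact erase_insert (hnot T (mem_filter.1 hT).1)
        · intro T hT
          rw [← mul_prod_erase _ _ (mem_filter.1 hT).2.2, neg_mul]

/-- The sequence `a` with `a 0 = 1` and `a (n + 1) = -∑ k, n.choose k * (σ (k + 1) * a (n - k))`,
whose exponential generating function is `exp (-∑ σ n xⁿ / n!)`, the sum being over `n ≥ 1`. -/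
def expNegSeq (σ : ℕ → R) : ℕ → R
  | 0 => 1
  | n + 1 => -∑ k : Fin (n + 1), n.choose k * (σ (k + 1) * expNegSeq σ (n - k))

theorem expNegSeq_succ (σ : ℕ → R) (n : ℕ) : expNegSeq σ (n + 1) =
    -∑ k ∈ range (n + 1), n.choose k * (σ (k + 1) * expNegSeq σ (n - k)) := by
  rw [expNegSeq, Fin.sum_univ_eq_sum_range
    (fun k => (n.choose k : R) * (σ (k + 1) * expNegSeq σ (n - k)))]

/-- If the strong enumerator depends only on the number of vertices, then so does the signed
enumerator of disjoint unions. -/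
theorem signedSum_eq_expNegSeq (w : V × V → R) {σ : ℕ → R}
    (hσ : ∀ C : Finset V, strongSum w C = σ C.card) (A : Finset V) :
    signedSum w A = expNegSeq σ A.card := by
  induction hn : A.card using Nat.strong_induction_on generalizing A with
  | _ n ih =>
  rcases A.eq_empty_or_nonempty with rfl | ⟨m, hm⟩
  · rw [← hn, signedSum_empty, card_empty, expNegSeq]
  · obtain ⟨B, hmB, rfl⟩ : ∃ B, m ∉ B ∧ insert m B = A :=
      ⟨A.erase m, notMem_erase _ _, insert_erase hm⟩
    rw [card_insert_of_notMem hmB] at hn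
    subst hn
    rw [signedSum_eq_neg_sum w hm, expNegSeq_succ, neg_inj]
    have h := sum_powerset_apply_card (fun k => σ (k + 1) * expNegSeq σ (B.card - k)) (x := B)
    simp only [nsmul_eq_mul] at h
    rw [← h]
    have hmem : ∀ {C}, C ⊆ B → m ∉ C := fun hC hmC => hmB (hC hmC)
    symm
    refine sum_bij' (fun C _ => insert m C) (fun C _ => C.erase m) ?_ ?_ ?_ ?_ ?_
    · intro C hC
      simp only [mem_filter, mem_powerset] at hC ⊢
      exact ⟨insert_subset_insert _ hC, mem_insert_self _ _⟩
    · intro C hC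
      simp only [mem_filter, mem_powerset] at hC ⊢
      rw [← subset_insert_iff]
      exact hC.1
    · intro C hC
      exact erase_insert (hmem (mem_powerset.1 hC))
    · intro C hC
      exact insert_erase (mem_filter.1 hC).2
    · intro C hC
      have hC' := mem_powerset.1 hC
      have hcard : (insert m B \ insert m C).card = B.card - C.card := by
        rw [card_sdiff_of_subset (insert_subset_insert _ hC'), card_insert_of_notMem hmB,
          card_insert_of_notMem (hmem hC'), Nat.add_sub_add_right]
      rw [hσ, card_insert_of_notMem (hmem hC'), ih _ (by omega) _ hcard]

end EdgeSets

/-! ### Digraphs as weighted edge sets -/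

/-- The contribution of an edge to the descent-edge polynomial: `u * y` for a descent, otherwise
`y`. -/
def arcWeight {V : Type*} [LinearOrder V] (e : V × V) : RatUY := if e.2 < e.1 then u * y else y

/-- The loopless digraphs on `Fin n` correspond to the subsets of `univ.offDiag`. -/
theorem algebraMap_descentEdgePoly {n : ℕ} (P : Finset (Fin n × Fin n) → Prop) [DecidablePred P]
    (B : Set (Digraph (Fin n)))
    (hB : ∀ G, G ∈ B ↔ G ∈ allDigraphs n ∧ P (univ.filter fun e => G.Adj e.1 e.2)) :
    algebraMap Poly RatUY (descentEdgePoly B) =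
      ∑ E ∈ (univ : Finset (Fin n)).offDiag.powerset with P E, ∏ e ∈ E, arcWeight e := by
  rw [descentEdgePoly, map_sum]
  refine sum_bij' (fun G _ => univ.filter fun e : Fin n × Fin n => G.Adj e.1 e.2)
    (fun E _ => ⟨fun a b => (a, b) ∈ E⟩) ?_ ?_ ?_ ?_ ?_
  · intro G hG
    rw [Set.Finite.mem_toFinset, hB] at hG
    refine mem_filter.2 ⟨mem_powerset.2 fun e he => ?_, hG.2⟩
    have he := (mem_filter.1 he).2
    exact mem_offDiag.2 ⟨mem_univ _, mem_univ _, fun h => hG.1 e.2 (by rwa [h] at he)⟩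
  · intro E hE
    rw [mem_filter, mem_powerset] at hE
    rw [Set.Finite.mem_toFinset, hB]
    refine ⟨fun v hv => (mem_offDiag.1 (hE.1 hv)).2.2 rfl, ?_⟩
    convert hE.2
    ext
    simp
  · intro G hG
    ext
    simp
  · intro E hE
    ext
    simp
  · intro G hG
    simp only [arcWeight]
    rw [prod_ite, prod_const, prod_const, map_mul, map_pow, map_pow, ← u.eq_1, ← y.eq_1, mul_pow,
      mul_assoc, ← pow_add, card_filter_add_card_filter_not, filter_filter]
    rfl

theorem algebraMap_strong (n : ℕ) :
    algebraMap Poly RatUY (descentEdgePoly (strongDigraphs n)) =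
      strongSum arcWeight (univ : Finset (Fin n)) := by
  rw [strongSum]
  refine algebraMap_descentEdgePoly _ _ fun G => and_congr_right fun hG => ?_
  have : ∀ a b, ((a, b) ∈ (univ.filter fun e : Fin n × Fin n => G.Adj e.1 e.2) ∧
      (a, b) ∈ (univ : Finset (Fin n)).offDiag) ↔ G.Adj a b := by
    intro a b
    simp only [mem_filter, mem_univ, true_and, mem_offDiag, and_iff_left_iff_imp]
    rintro h rfl
    exact hG a h
  simp only [IsStrong, StrongOn, this, mem_univ, forall_const]

/-- The strong enumerator is invariant under relabelling. -/
theorem strongSum_map {V V' R : Type*} [DecidableEq V] [DecidableEq V'] [CommRing R] (f : V ↪ V')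
    (w : V × V → R) (w' : V' × V' → R) (hw : ∀ e, w' (f.prodMap f e) = w e) (C : Finset V) :
    strongSum w' (C.map f) = strongSum w C := by
  have hoff : (C.map f).offDiag = C.offDiag.map (f.prodMap f) := by
    ext ⟨a, b⟩
    simp only [mem_offDiag, mem_map, Function.Embedding.coe_prodMap, Prod.exists, Prod.map,
      Prod.mk.injEq]
    constructor
    · rintro ⟨⟨a, ha, rfl⟩, ⟨b, hb, rfl⟩, hab⟩
      exact ⟨a, b, ⟨ha, hb, fun h => hab (h ▸ rfl)⟩, rfl, rfl⟩
    · rintro ⟨a, b, ⟨ha, hb, hab⟩, rfl, rfl⟩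
      exact ⟨⟨a, ha, rfl⟩, ⟨b, hb, rfl⟩, fun h => hab (f.injective h)⟩
  have hstrong : ∀ E, StrongOn (C.map f) (E.map (f.prodMap f)) ↔ StrongOn C E := by
    intro E
    simp only [StrongOn, forall_mem_map]
    have hrel : ∀ a b, ((f a, f b) ∈ E.map (f.prodMap f) ∧ (f a, f b) ∈ (C.map f).offDiag) ↔
        ((a, b) ∈ E ∧ (a, b) ∈ C.offDiag) := by
      intro a b
      rw [hoff]
      exact and_congr (mem_map' (f.prodMap f) (a := (a, b))) (mem_map' (f.prodMap f) (a := (a, b)))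
    refine forall₂_congr fun v _ => forall₂_congr fun v' _ => ⟨fun h => ?_, fun h => ?_⟩
    · generalize hx : f v = x at h
      induction h using Relation.ReflTransGen.head_induction_on generalizing v with
      | refl => rw [f.injective hx]
      | head h1 _ ih =>
        subst hx
        obtain ⟨-, h2, -⟩ := mem_offDiag.1 h1.2
        obtain ⟨d, hd, hd'⟩ := mem_map.1 h2
        simp only at hd'
        subst hd'
        exact .head ((hrel _ _).1 h1) (ih d hd rfl)
    · exact h.lift f fun a b hab => (hrel a b).2 hab
  rw [strongSum, strongSum, hoff]
  symm
  refine sum_bij (fun E _ => E.map (f.prodMap f)) ?_ ?_ ?_ ?_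
  · intro E hE
    rw [mem_filter, mem_powerset] at hE ⊢
    exact ⟨map_subset_map.2 hE.1, (hstrong E).2 hE.2⟩
  · exact fun E _ F _ h => map_injective _ h
  · intro F hF
    rw [mem_filter, mem_powerset] at hF
    obtain ⟨E, hE, rfl⟩ := subset_map_iff.1 hF.1
    exact ⟨E, mem_filter.2 ⟨mem_powerset.2 hE, (hstrong E).1 hF.2⟩, rfl⟩
  · intro E _
    rw [prod_map]
    exact prod_congr rfl fun e _ => (hw e).symm

theorem strongSum_arcWeight (C : Finset ℕ) : strongSum arcWeight C =
    algebraMap Poly RatUY (descentEdgePoly (strongDigraphs C.card)) := by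
  rw [algebraMap_strong, ← strongSum_map (C.orderEmbOfFin rfl).toEmbedding arcWeight arcWeight,
    map_orderEmbOfFin_univ]
  intro e
  simp [arcWeight]

/-- The enumerator of all digraphs on `A`: the potential edges are half ascents, half descents. -/
theorem prod_arcWeight {V : Type*} [LinearOrder V] (A : Finset V) :
    ∏ e ∈ A.offDiag, (1 + arcWeight e) =
      (1 + y) ^ A.card.choose 2 * (1 + u * y) ^ A.card.choose 2 := by
  induction A using Finset.induction_on_max with
  | empty => simp
  | insert a s ha ih =>
    have has : a ∉ s := fun h => lt_irrefl _ (ha a h)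
    have h1 : ∏ e ∈ ({a} : Finset V) ×ˢ s, (1 + arcWeight e) = (1 + u * y) ^ s.card := by
      rw [prod_product, prod_singleton]
      exact prod_eq_pow_card fun b hb => by simp [arcWeight, ha b hb]
    have h2 : ∏ e ∈ s ×ˢ ({a} : Finset V), (1 + arcWeight e) = (1 + y) ^ s.card := by
      rw [prod_product_right, prod_singleton]
      exact prod_eq_pow_card fun b hb => by simp [arcWeight, (ha b hb).le]
    rw [offDiag_insert has, prod_union, prod_union, h1, h2, ih, card_insert_of_notMem has,
      Nat.choose_succ_succ', Nat.choose_one_right]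
    · ring
    · rw [Finset.disjoint_left]
      rintro e h h'
      simp only [mem_offDiag, mem_product, mem_singleton] at h h'
      exact has (h'.1 ▸ h.1)
    · rw [Finset.disjoint_left]
      rintro e h h'
      simp only [mem_offDiag, mem_product, mem_singleton, mem_union] at h h'
      rcases h with h | h
      · exact has (h'.2 ▸ h.2.1)
      · exact has (h.1 ▸ h'.1)

theorem algebraMap_all (n : ℕ) :
    algebraMap Poly RatUY (descentEdgePoly (allDigraphs n)) =
      (1 + y) ^ n.choose 2 * (1 + u * y) ^ n.choose 2 := by
  rw [algebraMap_descentEdgePoly (fun _ => True) _ fun G => by simp, filter_true, ← prod_one_add,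
    prod_arcWeight, card_univ, Fintype.card_fin]

/-! ### Gaussian binomial coefficients -/

/-- The Gaussian binomial coefficient in the homogeneous form `p ^ (k * (n - k)) * [n, k]_{r / p}`.
It counts the `k`-subsets of `range n`, a pair `(a, b)` of an element `a` and a non-element `b`
having weight `p` if `a < b` and `r` if `a > b`. -/
def gaussBinom {R : Type*} [CommSemiring R] (p r : R) : ℕ → ℕ → R
  | _, 0 => 1
  | 0, _ + 1 => 0
  | n + 1, k + 1 => p ^ (k + 1) * gaussBinom p r n (k + 1) + r ^ (n - k) * gaussBinom p r n k

theorem gaussBinom_zero_right {R : Type*} [CommSemiring R] (p r : R) (n : ℕ) :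
    gaussBinom p r n 0 = 1 := by
  cases n <;> rfl

theorem gaussBinom_of_lt {R : Type*} [CommSemiring R] (p r : R) {n k : ℕ} (h : n < k) :
    gaussBinom p r n k = 0 := by
  induction n generalizing k with
  | zero =>
    obtain ⟨k, rfl⟩ := Nat.exists_eq_succ_of_ne_zero h.ne'
    rfl
  | succ n ih =>
    obtain ⟨k, rfl⟩ := Nat.exists_eq_succ_of_ne_zero (Nat.ne_zero_of_lt h)
    rw [gaussBinom, ih (by omega), ih (by omega), mul_zero, mul_zero, add_zero]

theorem gaussBinom_self {R : Type*} [CommSemiring R] (p r : R) (n : ℕ) :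
    gaussBinom p r n n = 1 := by
  induction n with
  | zero => rfl
  | succ n ih => simp [gaussBinom, gaussBinom_of_lt, ih]

/-- The sum over all subsets of `range n` of a function of the size, weighted by the edge sets
between the subset and its complement. -/
theorem sum_powerset_range_cross (f : ℕ → RatUY) (n : ℕ) :
    ∑ A ∈ (range n).powerset, f A.card * ∏ e ∈ A ×ˢ (range n \ A), (1 + arcWeight e) =
      ∑ k ∈ range (n + 1), f k * gaussBinom (1 + y) (1 + u * y) n k := by
  induction n generalizing f with
  | zero => simp [gaussBinom]
  | succ n ih =>
    -- If `n` is not in the subset, it is the larger end of all its pairs, which have weight `1 + y`.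
    have h1 : ∀ A ∈ (range n).powerset,
        f A.card * ∏ e ∈ A ×ˢ (range (n + 1) \ A), (1 + arcWeight e) =
          f A.card * (1 + y) ^ A.card * ∏ e ∈ A ×ˢ (range n \ A), (1 + arcWeight e) := by
      intro A hA
      have hA := mem_powerset.1 hA
      have hn : n ∉ A := fun h => notMem_range_self (hA h)
      have hx : ∏ a ∈ A, (1 + arcWeight (a, n)) = (1 + y) ^ A.card :=
        prod_eq_pow_card fun b hb => by
          have := mem_range.1 (hA hb)
          simp [arcWeight, this.le]
      rw [range_add_one, insert_sdiff_of_notMem _ hn, prod_product, prod_product, mul_assoc, ← hx,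
        ← prod_mul_distrib]
      congr 1
      exact prod_congr rfl fun a _ => prod_insert (by simp)
    -- If `n` is in the subset, all its pairs are descents.
    have h2 : ∀ A ∈ (range n).powerset,
        f (insert n A).card *
            ∏ e ∈ insert n A ×ˢ (range (n + 1) \ insert n A), (1 + arcWeight e) =
          f (A.card + 1) * (1 + u * y) ^ (n - A.card) *
            ∏ e ∈ A ×ˢ (range n \ A), (1 + arcWeight e) := by
      intro A hA
      have hA := mem_powerset.1 hA
      have hn : n ∉ A := fun h => notMem_range_self (hA h)
      have hs : range (n + 1) \ insert n A = range n \ A := by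
        rw [range_add_one, insert_sdiff_insert, sdiff_insert_of_notMem notMem_range_self]
      have hx : ∏ b ∈ range n \ A, (1 + arcWeight (n, b)) = (1 + u * y) ^ (n - A.card) := by
        rw [prod_eq_pow_card (b := 1 + u * y), card_sdiff_of_subset hA, card_range]
        intro b hb
        have := mem_range.1 (mem_sdiff.1 hb).1
        simp [arcWeight, this]
      rw [hs, card_insert_of_notMem hn, prod_product, prod_product, prod_insert hn, hx, mul_assoc]
    -- The term `k = n + 1` vanishes, so the index can be shifted without a boundary term at the top.
    have h3 : ∑ k ∈ range (n + 1), f (k + 1) * (1 + y) ^ (k + 1) *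
          gaussBinom (1 + y) (1 + u * y) n (k + 1) + f 0 =
        ∑ k ∈ range (n + 1), f k * (1 + y) ^ k * gaussBinom (1 + y) (1 + u * y) n k := by
      have h := sum_range_succ'
        (fun k => f k * (1 + y) ^ k * gaussBinom (1 + y) (1 + u * y) n k) (n + 1)
      rw [sum_range_succ, gaussBinom_of_lt _ _ n.lt_succ_self] at h
      simpa [gaussBinom_zero_right] using h.symm
    rw [range_add_one, sum_powerset_insert notMem_range_self, ← range_add_one, sum_congr rfl h1,
      sum_congr rfl h2, ih (fun k => f k * (1 + y) ^ k),
      ih (fun k => f (k + 1) * (1 + u * y) ^ (n - k)), sum_range_succ' _ (n + 1), ← h3,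
      gaussBinom_zero_right, mul_one, add_right_comm, ← sum_add_distrib]
    congr 1
    refine sum_congr rfl fun k _ => ?_
    rw [gaussBinom]
    ring

/-- The quotient of consecutive denominators is the `q`-integer `1 + q + ⋯ + q ^ n` in the homogeneous
form `p ^ n + p ^ (n - 1) * r + ⋯ + r ^ n`, where `p = 1 + y` and `r = 1 + u * y`. -/
theorem egDenom_succ (n : ℕ) : egDenom (n + 1) =
    egDenom n * ∑ j ∈ range (n + 1), (1 + u * y) ^ j * (1 + y) ^ (n - j) := by
  have h : ∑ j ∈ range (n + 1), (1 + u * y) ^ j * (1 + y) ^ (n - j) =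
      (1 + y) ^ n * ∑ j ∈ range (n + 1), q ^ j := by
    rw [mul_sum]
    refine sum_congr rfl fun j hj => ?_
    have hj := Nat.lt_succ_iff.1 (mem_range.1 hj)
    have hp := pow_ne_zero j one_add_y_ne_zero
    rw [q, div_pow, mul_div_assoc', eq_div_iff hp, mul_assoc, ← pow_add, Nat.sub_add_cancel hj,
      mul_comm]
  rw [h, egDenom, egDenom, qFactorial, qFactorial, prod_range_succ, Nat.choose_succ_succ',
    Nat.choose_one_right, pow_add]
  ring

theorem geom_sum₂_add {R : Type*} [CommRing R] (p r : R) (a b : ℕ) :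
    ∑ j ∈ range (a + b), r ^ j * p ^ (a + b - 1 - j) =
      p ^ b * ∑ j ∈ range a, r ^ j * p ^ (a - 1 - j) +
        r ^ a * ∑ j ∈ range b, r ^ j * p ^ (b - 1 - j) := by
  rw [sum_range_add, mul_sum, mul_sum]
  congr 1 <;> refine sum_congr rfl fun j hj => ?_
  · have := mem_range.1 hj
    rw [show a + b - 1 - j = b + (a - 1 - j) by omega, pow_add]
    ring
  · rw [show a + b - 1 - (a + j) = b - 1 - j by omega, pow_add, mul_assoc]

theorem gaussBinom_mul_egDenom (a b : ℕ) :
    gaussBinom (1 + y) (1 + u * y) (a + b) a * (egDenom a * egDenom b) = egDenom (a + b) := by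
  have h0 : egDenom 0 = 1 := by simp [egDenom, qFactorial]
  induction hn : a + b generalizing a b with
  | zero =>
    obtain ⟨rfl, rfl⟩ : a = 0 ∧ b = 0 := by omega
    simp [gaussBinom, h0]
  | succ n ih =>
    rcases a with _ | a
    · rw [gaussBinom_zero_right, h0, one_mul, one_mul, ← hn, zero_add]
    rcases b with _ | b
    · rw [← hn, add_zero, gaussBinom_self, h0, one_mul, mul_one]
    have e1 := ih (a + 1) b (by omega)
    have e2 := ih a (b + 1) (by omega)
    have hg := geom_sum₂_add (1 + y) (1 + u * y) (b + 1) (a + 1)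
    rw [add_comm (b + 1), hn] at hg
    simp only [Nat.add_sub_cancel] at hg
    rw [gaussBinom, egDenom_succ n, hg, show n - a = b + 1 by omega, mul_add (egDenom n)]
    nth_rewrite 1 [← e1]
    rw [← e2, egDenom_succ a, egDenom_succ b]
    ring

/-! ### The generating functions -/

theorem constantCoeff_expGF (a : ℕ → RatUY) : PowerSeries.constantCoeff (expGF a) = a 0 := by
  rw [← PowerSeries.coeff_zero_eq_constantCoeff_apply, expGF, PowerSeries.coeff_mk]
  simp

theorem derivative_expGF_expNegSeq (σ : ℕ → RatUY) :
    PowerSeries.derivative RatUY (expGF (expNegSeq σ)) =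
      -PowerSeries.derivative RatUY (expGF fun n => if n = 0 then 0 else σ n) *
        expGF (expNegSeq σ) := by
  have hfac : ∀ n : ℕ, (n.factorial : RatUY) ≠ 0 := fun n => Nat.cast_ne_zero.2 n.factorial_ne_zero
  have hder : ∀ (a : ℕ → RatUY) (n : ℕ),
      PowerSeries.coeff n (PowerSeries.derivative RatUY (expGF a)) =
        a (n + 1) / n.factorial := by
    intro a n
    have h1 : (n + 1 : RatUY) ≠ 0 := by exact_mod_cast n.succ_ne_zero
    rw [PowerSeries.coeff_derivative, expGF, PowerSeries.coeff_mk, Nat.factorial_succ,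
      Nat.cast_mul, Nat.cast_succ]
    have := hfac n
    field_simp
  ext n
  rw [neg_mul, map_neg, PowerSeries.coeff_mul, hder, expNegSeq_succ, neg_div, neg_inj, sum_div,
    Nat.sum_antidiagonal_eq_sum_range_succ_mk]
  refine sum_congr rfl fun k hk => ?_
  have hk := Nat.lt_succ_iff.1 (mem_range.1 hk)
  rw [hder, if_neg k.succ_ne_zero, expGF, PowerSeries.coeff_mk, Nat.cast_choose _ hk]
  have := hfac n
  have := hfac k
  have := hfac (n - k)
  field_simp

/-- `logOf f` is determined by its constant term and by `(logOf f)' = f' / f`. -/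
theorem logOf_eq_neg_of_derivative {K : Type*} [Field K] [Algebra ℚ K] {f g : PowerSeries K}
    (hf : PowerSeries.constantCoeff f = 1) (hg : PowerSeries.constantCoeff g = 0)
    (h : PowerSeries.derivative K f = -PowerSeries.derivative K g * f) :
    PowerSeries.logOf f = -g := by
  have : CharZero K := algebraRat.charZero K
  have hs : PowerSeries.HasSubst (f - 1) :=
    PowerSeries.HasSubst.of_constantCoeff_zero' (by simp [hf])
  have hinv : (PowerSeries.derivative K (PowerSeries.log K)).subst (f - 1) * f = 1 := by
    have h1 : PowerSeries.derivative K (PowerSeries.log K) * (1 + PowerSeries.X) = 1 := by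
      rw [PowerSeries.deriv_log]
      ext n
      rcases n with _ | n
      · simp [PowerSeries.coeff_zero_eq_constantCoeff_apply]
      · rw [mul_add, mul_one, map_add, PowerSeries.coeff_succ_mul_X, PowerSeries.coeff_mk,
          PowerSeries.coeff_mk, PowerSeries.coeff_one, if_neg n.succ_ne_zero, pow_succ]
        simp
    have h2 := congrArg (PowerSeries.substAlgHom (R := K) hs) h1
    rw [map_mul, map_add, map_one, PowerSeries.coe_substAlgHom, PowerSeries.subst_X hs] at h2
    simpa using h2
  refine PowerSeries.derivative.ext ?_ ?_
  · rw [PowerSeries.logOf_eq, PowerSeries.derivative_subst hs, map_sub,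
      PowerSeries.derivative_one, sub_zero, h, map_neg, mul_left_comm, hinv, mul_one]
  · rw [PowerSeries.constantCoeff_logOf hf, map_neg, hg, neg_zero]

/-- The coefficient sequence of `exp (-S(x))`. -/
def invSeq : ℕ → RatUY :=
  expNegSeq fun n => algebraMap Poly RatUY (descentEdgePoly (strongDigraphs n))

theorem eulerianGraphicGF_invSeq_mul_digraphGF : eulerianGraphicGF invSeq * digraphGF = 1 := by
  ext n
  rw [PowerSeries.coeff_mul, PowerSeries.coeff_one,
    Nat.sum_antidiagonal_eq_sum_range_succ_mk]
  have hterm : ∀ k ∈ range (n + 1),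
      PowerSeries.coeff k (eulerianGraphicGF invSeq) * PowerSeries.coeff (n - k) digraphGF =
        invSeq k * ((1 + y) ^ (n - k).choose 2 * (1 + u * y) ^ (n - k).choose 2) *
          gaussBinom (1 + y) (1 + u * y) n k / egDenom n := by
    intro k hk
    have hk := Nat.lt_succ_iff.1 (mem_range.1 hk)
    have hg := gaussBinom_mul_egDenom k (n - k)
    rw [Nat.add_sub_cancel' hk] at hg
    have h1 := egDenom_ne_zero n
    have h2 := egDenom_ne_zero k
    have h3 := egDenom_ne_zero (n - k)
    rw [digraphGF, eulerianGraphicGF, eulerianGraphicGF, PowerSeries.coeff_mk,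
      PowerSeries.coeff_mk, algebraMap_all, div_mul_div_comm, div_eq_div_iff (mul_ne_zero h2 h3) h1,
      ← hg]
    ring
  rw [sum_congr rfl hterm, ← sum_div, ← sum_powerset_range_cross
    (fun k => invSeq k * ((1 + y) ^ (n - k).choose 2 * (1 + u * y) ^ (n - k).choose 2))]
  split_ifs with hn
  · subst hn
    simp [invSeq, expNegSeq, egDenom, qFactorial]
  · have h := sum_signedSum_eq_zero (arcWeight (V := ℕ)) (nonempty_range_iff.2 hn)
    rw [div_eq_zero_iff]
    left
    rw [← h]
    refine sum_congr rfl fun A hA => ?_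
    rw [signedSum_eq_expNegSeq arcWeight
      (σ := fun n => algebraMap Poly RatUY (descentEdgePoly (strongDigraphs n)))
      strongSum_arcWeight, prod_arcWeight, card_sdiff_of_subset (mem_powerset.1 hA), card_range,
      invSeq]
    ring

theorem constantCoeff_digraphGF : PowerSeries.constantCoeff digraphGF = 1 := by
  rw [← PowerSeries.coeff_zero_eq_constantCoeff_apply, digraphGF, eulerianGraphicGF,
    PowerSeries.coeff_mk, algebraMap_all]
  simp [egDenom, qFactorial]

theorem Delta_symm_inv_digraphGF : Delta.symm digraphGF⁻¹ = expGF invSeq := by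
  have h : digraphGF⁻¹ = eulerianGraphicGF invSeq := by
    rw [eq_comm, PowerSeries.eq_inv_iff_mul_eq_one (by simp [constantCoeff_digraphGF])]
    exact eulerianGraphicGF_invSeq_mul_digraphGF
  rw [h, Equiv.symm_apply_eq]
  exact congrArg eulerianGraphicGFEquiv (expGFEquiv.symm_apply_apply invSeq).symm

end StrongDigraph

end

theorem theorem3p6 :
    -- the explicit form of `D(x)`
    StrongDigraph.digraphGF = PowerSeries.mk (fun n : ℕ =>
        (1 + StrongDigraph.u * StrongDigraph.y) ^ n.choose 2 /
          StrongDigraph.qFactorial StrongDigraph.q n) ∧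
    -- the inverse of `D(x)` and the logarithm below are the genuine ones
    PowerSeries.constantCoeff StrongDigraph.digraphGF ≠ 0 ∧
    PowerSeries.constantCoeff (StrongDigraph.Delta.symm StrongDigraph.digraphGF⁻¹) = 1 ∧
    StrongDigraph.strongGF =
      -PowerSeries.logOf (StrongDigraph.Delta.symm StrongDigraph.digraphGF⁻¹) := by
  open StrongDigraph in
  have hone : PowerSeries.constantCoeff (expGF invSeq) = 1 := by
    rw [constantCoeff_expGF, invSeq, expNegSeq]
  refine ⟨?_, ?_, ?_, ?_⟩
  · ext n
    rw [digraphGF, eulerianGraphicGF, PowerSeries.coeff_mk, PowerSeries.coeff_mk, algebraMap_all,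
      egDenom, mul_div_mul_left _ _ (pow_ne_zero _ one_add_y_ne_zero)]
  · rw [constantCoeff_digraphGF]
    exact one_ne_zero
  · rw [Delta_symm_inv_digraphGF, hone]
  · rw [Delta_symm_inv_digraphGF, logOf_eq_neg_of_derivative (g := strongGF) hone
      (by rw [strongGF, constantCoeff_expGF, if_pos rfl]) (derivative_expGF_expNegSeq _), neg_neg]
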